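/- A *combinatorial complex* is a Hausdorff CW complex $X$ such that for every $n$-cell $e$ the boundary sphere of the $n$-disc from which $e$ is attached carries the structure of a combinatorial complex for which the attaching map of $e$ is combinatorial, i.e. maps each open cell homeomorphically onto an open cell of $X$. A group $G$ acts on $X$ *by cellular automorphisms* if each $g\in G$ acts by a homeomorphism that maps open cells onto open cells. The action is *proper* if for every compact subcomplex $K$ of $X$ the set $\{g\in G : K\cap gK\neq\emptyset\}$ is finite, and *cocompact* if there is a compact subcomplex $K$ of $X$ with $\bigcup_{g\in G} gK=X$. Choose an orientation of every cell of $X$. The cellular chain group $C_n(X,\mathbb Z)$ is the free $\mathbb Z$-module on the $n$-cells, with boundary maps $\partial_n\colon C_n(X,\mathbb Z)\to C_{n-1}(X,\mathbb Z)$, and $\|c\|_1$ denotes the sum of the absolute values of the coefficients of a chain $c$. The complex $X$ is *$d$-acyclic* if its reduced (cellular) homology groups $\tilde H_i(X,\mathbb Z)$ vanish for $0\le i\le d$. For $d\geq 1$ let $Z_d(X,\mathbb Z)=\ker\partial_d$, and for $\gamma\in Z_d(X,\mathbb Z)$ and $m\in\mathbb N$ put $$\|\gamma\|_\partial=\inf\{\|\mu\|_1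 : \mu\in C_{d+1}(X,\mathbb Z),\ \partial_{d+1}\mu=\gamma\},\qquad FV_X^{d+1}(m)=\sup\{\|\gamma\|_\partial : \gamma\in Z_d(X,\mathbb Z),\ \|\gamma\|_1\le m\},$$ both in $\mathbb N\cup\{\infty\}$, where $\inf\emptyset=\infty$ and $\sup\emptyset=0$. **Theorem.** Let $d$ be a positive integer and let $G$ be a group acting properly and cocompactly by cellular automorphisms on a $d$-acyclic combinatorial complex $X$. Then $FV_X^{d+1}(m)$ is finite for every $m\in\mathbb N$. -/

import Mathlib

open Topology Metric Set

universe u v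

/-- The index type of the `k`-cells of a given CW structure `h`. -/
abbrev CWCell {Y : Type u} [TopologicalSpace Y] {C : Set Y} (h : CWComplex C) (k : ℕ) : Type u :=
  @RelCWComplex.cell Y _ C ∅ (@CWComplex.instRelCWComplex Y _ C h) k

/-- The characteristic map of a `k`-cell of a given CW structure `h`, defined on the closed unit
ball of `Fin k → ℝ` (which is a closed `k`-disc). -/
abbrev cwMap {Y : Type u} [TopologicalSpace Y] {C : Set Y} (h : CWComplex C) {k : ℕ}
    (σ : CWCell h k) : (Fin k → ℝ) → Y :=
  @RelCWComplex.map Y _ C ∅ (@CWComplex.instRelCWComplex Y _ C h) k σ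

/-- The boundary sphere of the closed `n`-disc; it is empty for `n = 0`. -/
abbrev discBoundary (n : ℕ) : Set (Fin n → ℝ) := sphere (0 : Fin n → ℝ) 1

/-- A combinatorial complex in the sense of Bridson and Haefliger: a CW complex `X` such that, for
every `n`-cell `e`, the boundary sphere of the `n`-disc is itself (homeomorphic to) a combinatorial
complex `boundaryCW e`, and the attaching map of `e` is a combinatorial map from `boundaryCW e` to
`X`, that is, it maps every open cell of `boundaryCW e` homeomorphically onto an open cell of `X`.

A homeomorphism between the interiors of two such cells extends to the closed discs, so the
characteristic maps of the cells of `boundaryCW e` may be (and are) taken to be lifts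
of the characteristic maps of the cells of `X` onto which they are mapped. The complex
`boundaryCW e` is then itself combinatorial, the boundary sphere of a cell `σ` of it being subdivided
as the boundary sphere of the image of `σ` in `X`. -/
class CombinatorialComplex (X : Type u) [TopologicalSpace X] where
  /-- The underlying CW structure. -/
  cw : CWComplex (univ : Set X)
  /-- The cell structure on the boundary sphere of the `n`-disc from which `e` is attached. -/
  boundaryCW {n : ℕ} (e : CWCell cw n) : CWComplex (discBoundary n)
  /-- The `k`-cell of `X` onto which a `k`-cell of the boundary sphere of `e` is mapped. -/
  face {n : ℕ} (e : CWCell cw n) {k : ℕ} (σ : CWCell (boundaryCW e) k) : CWCell cw k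
  /-- The attaching map of `e` is combinatorial. -/
  map_face {n : ℕ} (e : CWCell cw n) {k : ℕ} (σ : CWCell (boundaryCW e) k) :
    ∀ x ∈ closedBall (0 : Fin k → ℝ) 1,
      cwMap cw e (cwMap (boundaryCW e) σ x) = cwMap cw (face e σ) x
  /-- The `j`-cell of the boundary sphere of `e` onto which a `j`-cell of the boundary sphere of
  a `k`-cell `σ` is mapped. -/
  subface {n : ℕ} (e : CWCell cw n) {k : ℕ} (σ : CWCell (boundaryCW e) k) {j : ℕ}
    (τ : CWCell (boundaryCW (face e σ)) j) : CWCell (boundaryCW e) j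
  /-- The attaching map of a cell `σ` of the boundary sphere of `e` is combinatorial. -/
  map_subface {n : ℕ} (e : CWCell cw n) {k : ℕ} (σ : CWCell (boundaryCW e) k) {j : ℕ}
    (τ : CWCell (boundaryCW (face e σ)) j) :
    ∀ x ∈ closedBall (0 : Fin j → ℝ) 1,
      cwMap (boundaryCW e) σ (cwMap (boundaryCW (face e σ)) τ x) =
        cwMap (boundaryCW e) (subface e σ τ) x

attribute [reducible, instance] CombinatorialComplex.cw

namespace CombinatorialComplex

noncomputable section

/-- The type of `n`-cells of `X`. -/
abbrev Cell (X : Type u) [TopologicalSpace X] [CombinatorialComplex X] (n : ℕ) : Type u :=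
  CWCell (cw (X := X)) n

/-- The cellular chain group `C_n(X, ℤ)`: the free `ℤ`-module on the `n`-cells, each of which
carries its chosen orientation. -/
abbrev Chain (X : Type u) [TopologicalSpace X] [CombinatorialComplex X] (n : ℕ) : Type u :=
  Cell X n →₀ ℤ

/-- The cellular `k`-chains of the boundary sphere of a cell `e`. -/
abbrev SphereChain {X : Type u} [TopologicalSpace X] [CombinatorialComplex X] {n : ℕ}
    (e : Cell X n) (k : ℕ) : Type :=
  CWCell (boundaryCW e) k →₀ ℤ

/-- The cellular boundary map `C_{k+1} → C_k` of the boundary sphere of a cell `e`. Here `ω`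
gives, for each `(k+1)`-cell `f` of `X`, a `k`-chain of the boundary sphere of `f` that represents
its orientation; a `(k+1)`-cell `σ` of the boundary sphere of `e` has the orientation of its image
`face e σ`, and its boundary is the image of `ω (face e σ)`. -/
def sphereBoundary {X : Type u} [TopologicalSpace X] [CombinatorialComplex X] {k : ℕ}
    (ω : ∀ f : Cell X (k + 1), SphereChain f k) {n : ℕ} (e : Cell X n) :
    SphereChain e (k + 1) →ₗ[ℤ] SphereChain e k :=
  Finsupp.linearCombination ℤ fun σ => Finsupp.mapDomain (subface e σ) (ω (face e σ))

/-- The group of reduced cellular `k`-cycles of the boundary sphere of a cell `e`, for given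
orientations `ω` of the cells of `X`. In degree `0` this is the kernel of the augmentation. -/
def sphereCycles {X : Type u} [TopologicalSpace X] [CombinatorialComplex X]
    (ω : ∀ (k : ℕ) (f : Cell X (k + 1)), SphereChain f k) {n : ℕ} (e : Cell X n) :
    (k : ℕ) → Submodule ℤ (SphereChain e k)
  | 0 => LinearMap.ker (Finsupp.linearCombination ℤ fun _ => (1 : ℤ))
  | k + 1 => LinearMap.ker (sphereBoundary (ω k) e)

/-- A choice of an orientation for each cell of `X`. Points need no choice (they are positively
oriented). An orientation of an `(n+1)`-cell `e` is a fundamental cycle of its boundary sphere: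
one of the two generators of the infinite cyclic group of reduced `n`-cycles of this `n`-sphere
(which has no cells of dimension above `n`, so this is its reduced `n`-th homology group). -/
structure Orientation (X : Type u) [TopologicalSpace X] [CombinatorialComplex X] where
  /-- The fundamental cycle of the boundary sphere of `e`. -/
  fundCycle (n : ℕ) (e : Cell X (n + 1)) : SphereChain e n
  /-- It generates the group of reduced cycles. -/
  span_fundCycle (n : ℕ) (e : Cell X (n + 1)) :
    Submodule.span ℤ {fundCycle n e} = sphereCycles fundCycle e n

section Homology

variable {X : Type u} [TopologicalSpace X] [CombinatorialComplex X]

/-- The cellular boundary map `∂_{n+1} : C_{n+1}(X, ℤ) → C_n(X, ℤ)`: it sends an `(n+1)`-cell to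
the image of the fundamental cycle of its boundary sphere under the attaching map. -/
def boundary (o : Orientation X) (n : ℕ) : Chain X (n + 1) →ₗ[ℤ] Chain X n :=
  Finsupp.linearCombination ℤ fun e => Finsupp.mapDomain (face e) (o.fundCycle n e)

/-- The augmentation `C_0(X, ℤ) → ℤ`. -/
def augmentation (X : Type u) [TopologicalSpace X] [CombinatorialComplex X] : Chain X 0 →ₗ[ℤ] ℤ :=
  Finsupp.linearCombination ℤ fun _ => (1 : ℤ)

/-- The group of (reduced) cellular `n`-cycles: the kernel of the boundary map for `n ≥ 1`, and the
kernel of the augmentation for `n = 0`. -/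
def cycles (o : Orientation X) : (n : ℕ) → Submodule ℤ (Chain X n)
  | 0 => LinearMap.ker (augmentation X)
  | n + 1 => LinearMap.ker (boundary o n)

/-- The reduced cellular homology group of `X` in degree `n`: cycles modulo boundaries. -/
abbrev ReducedHomology (o : Orientation X) (n : ℕ) : Type u :=
  cycles o n ⧸ (LinearMap.range (boundary o n)).submoduleOf (cycles o n)

/-- `X` is `d`-acyclic: its reduced homology vanishes in the degrees `0, …, d`. -/
def IsAcyclic (o : Orientation X) (d : ℕ) : Prop :=
  ∀ i ≤ d, Subsingleton (ReducedHomology o i)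

/-- The `ℓ₁`-norm of a cellular chain: the sum of the absolute values of its coefficients. -/
def norm₁ {n : ℕ} (c : Chain X n) : ℕ := c.sum fun _ a => a.natAbs

/-- The filling norm of a `d`-chain: the least `ℓ₁`-norm of a `(d+1)`-chain with boundary `γ`; it is
`⊤` if there is none. -/
def fillingNorm (o : Orientation X) {d : ℕ} (γ : Chain X d) : ℕ∞ :=
  ⨅ (μ : Chain X (d + 1)) (_ : boundary o d μ = γ), (norm₁ μ : ℕ∞)

/-- The `(d+1)`-dimensional filling function of `X`: `fillingFunction o d k` is the supremum of
the filling norms of the `d`-cycles of `ℓ₁`-norm at most `k`. -/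
def fillingFunction (o : Orientation X) (d : ℕ) (k : ℕ) : ℕ∞ :=
  ⨆ (γ : Chain X d) (_ : γ ∈ cycles o d) (_ : norm₁ γ ≤ k), fillingNorm o γ

end Homology

/-- The group `G` acts on `X` by cellular automorphisms: each element acts by a homeomorphism
that maps each open cell onto an open cell (of the same dimension). -/
structure IsCellularAction (G : Type v) (X : Type u) [TopologicalSpace X]
    [CombinatorialComplex X] [Group G] [MulAction G X] : Prop where
  continuous_smul (g : G) : Continuous fun x : X => g • x
  map_openCell (g : G) (n : ℕ) (e : Cell X n) : ∃ e' : Cell X n,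
    (fun x : X => g • x) '' RelCWComplex.openCell n e = RelCWComplex.openCell n e'

/-- The action is proper: for each compact subcomplex `K`, the set of all `g` with
`K ∩ gK ≠ ∅` is finite. -/
def IsProperAction (G : Type v) (X : Type u) [TopologicalSpace X] [CombinatorialComplex X]
    [Group G] [MulAction G X] : Prop :=
  ∀ K : RelCWComplex.Subcomplex (univ : Set X), IsCompact (K : Set X) →
    {g : G | ((K : Set X) ∩ (fun x : X => g • x) '' (K : Set X)).Nonempty}.Finite

/-- The action is cocompact: the translates of some compact subcomplex cover `X`. -/
def IsCocompactAction (G : Type v) (X : Type u) [TopologicalSpace X] [CombinatorialComplex X]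
    [Group G] [MulAction G X] : Prop :=
  ∃ K : RelCWComplex.Subcomplex (univ : Set X), IsCompact (K : Set X) ∧
    ⋃ g : G, (fun x : X => g • x) '' (K : Set X) = univ

end

end CombinatorialComplex

/-!
The theorem rests on a splitting argument for `d`-cycles that needs only local finiteness, and on
the fact that `G` acts on the cellular chain complex.

**Splitting** (`exists_bound_of_locally_finite`). By cocompactness every `d`-cell is a translate of
one in a finite set `E`, and by properness every point lies in finitely many closed `d`-cells
(`finite_setOf_mem_closedCell`), so that every `d`-cell shares `(d-1)`-cells of its boundary with
finitely many others. Let `γ` be a `d`-cycle of norm at most `m`; move it so that its support meets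
`E`. If its support lies in the `m`-th neighborhood of `E`, then `γ` is one of finitely many cycles,
each of which has a filling because `X` is `d`-acyclic. Otherwise the part of the support in some
neighborhood of `E` of radius at most `m` has no boundary cells in common with the rest, so `γ` is
the sum of two cycles of smaller norm, and induction applies. Here `d ≥ 1` matters: the parts of a
`0`-cycle need not lie in the kernel of the augmentation.

**The action on chains.** Orientations are fundamental cycles of boundary spheres, while a
cellular homeomorphism `f` of `X` is only given on `X`. If `f` carries the cell `e` to `e'`, it
lifts to the open discs. Since the attaching maps are combinatorial, the fibres of a characteristic
map are finite (`finite_fibre_cwMap`), and this is enough for the lift to extend continuously to the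
closed discs (`exists_tendsto_of_finite_fibre`). By connectedness the extension maps open cells of
one boundary sphere onto open cells of the other (`exists_mapsTo_discMap`), compatibly with the
maps `face` and `subface` (`carries_face`, `boundaryCell_subface`). By induction on the dimension
the two spheres have isomorphic groups of cycles, so the fundamental cycle of `e'` is the image of
that of `e` up to a sign (`fundCycle_eq_of_carries`). With these signs `f` induces
an automorphism of the cellular chain complex that preserves the `ℓ₁`-norm (`boundary_chainMap`,
`norm₁_chainMap`), hence translates of a cycle have the same filling norm.
-/

/-! ### Open cells of a CW complex -/

section CWComplex

variable {Y : Type u} [TopologicalSpace Y] {C : Set Y}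

/-- The open `k`-cell given by the index `σ`, for an explicitly given CW structure `h`. -/
abbrev cwOpenCell (h : CWComplex C) {k : ℕ} (σ : CWCell h k) : Set Y := cwMap h σ '' ball 0 1

lemma continuousOn_cwMap (h : CWComplex C) {k : ℕ} (σ : CWCell h k) :
    ContinuousOn (cwMap h σ) (closedBall 0 1) :=
  RelCWComplex.continuousOn k σ

lemma injOn_cwMap (h : CWComplex C) {k : ℕ} (σ : CWCell h k) :
    InjOn (cwMap h σ) (ball 0 1) := by
  have := (RelCWComplex.map k σ).injOn
  rwa [RelCWComplex.source_eq] at this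

lemma cwMap_mem (h : CWComplex C) {k : ℕ} (σ : CWCell h k) {x : Fin k → ℝ}
    (hx : x ∈ closedBall 0 1) : cwMap h σ x ∈ C :=
  RelCWComplex.closedCell_subset_complex k σ (mem_image_of_mem _ hx)

lemma eq_of_mem_cwOpenCell (h : CWComplex C) {k : ℕ} {σ τ : CWCell h k} {y : Y}
    (hσ : y ∈ cwOpenCell h σ) (hτ : y ∈ cwOpenCell h τ) : σ = τ := by
  have := RelCWComplex.eq_of_not_disjoint_openCell (j := σ) (i := τ)
    (not_disjoint_iff.2 ⟨y, hσ, hτ⟩)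
  simpa using this

lemma dim_eq_of_mem_cwOpenCell (h : CWComplex C) {k l : ℕ} {σ : CWCell h k} {τ : CWCell h l}
    {y : Y} (hσ : y ∈ cwOpenCell h σ) (hτ : y ∈ cwOpenCell h τ) : k = l :=
  congrArg Sigma.fst (RelCWComplex.eq_of_not_disjoint_openCell (j := σ) (i := τ)
    (not_disjoint_iff.2 ⟨y, hσ, hτ⟩))

lemma exists_mem_cwOpenCell (h : CWComplex C) {y : Y} (hy : y ∈ C) :
    ∃ (k : ℕ) (σ : CWCell h k), y ∈ cwOpenCell h σ := by
  rw [← CWComplex.iUnion_openCell_eq_complex (C := C)] at hy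
  simp only [mem_iUnion] at hy
  exact hy

variable [T2Space Y]

lemma cwMap_notMem_cwOpenCell (h : CWComplex C) {k : ℕ} (σ τ : CWCell h k) {x : Fin k → ℝ}
    (hx : x ∈ sphere 0 1) : cwMap h σ x ∉ cwOpenCell h τ := fun hy =>
  disjoint_left.1 (RelCWComplex.disjoint_skeletonLT_openCell (C := C) (n := k) (j := τ) le_rfl)
    (RelCWComplex.cellFrontier_subset_skeletonLT k σ (mem_image_of_mem _ hx)) hy

/-- A subset of a compact set is finite as soon as it meets every open cell in a finite set: all
its subsets are closed in the weak topology, so it is discrete. -/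
lemma finite_of_finite_inter_cwOpenCell (h : CWComplex C) {K A : Set Y} (hK : IsCompact K)
    (hKC : K ⊆ C) (hAK : A ⊆ K)
    (hA : ∀ (k : ℕ) (σ : CWCell h k), (A ∩ cwOpenCell h σ).Finite) : A.Finite := by
  have hclosed : ∀ B ⊆ A, IsClosed B := fun B hB =>
    CWComplex.isClosed_of_isClosed_inter_openCell_or_isClosed_inter_closedCell
      ((hB.trans hAK).trans hKC) fun n _ j => Or.inl
        ((hA n j).subset (inter_subset_inter_left _ hB)).isClosed
  refine (hK.of_isClosed_subset (hclosed A le_rfl) hAK).finite ?_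
  exact isDiscrete_iff_forall_mem_exists_isClosed.2 fun s hs =>
    ⟨s, hclosed s hs, inter_eq_left.2 hs⟩

/-- A compact set meets only finitely many open cells of each dimension. -/
lemma finite_setOf_inter_cwOpenCell (h : CWComplex C) {K : Set Y} (hK : IsCompact K)
    (hKC : K ⊆ C) (k : ℕ) : {σ : CWCell h k | (K ∩ cwOpenCell h σ).Nonempty}.Finite := by
  rcases isEmpty_or_nonempty Y with _ | _
  · exact Set.finite_empty.subset fun σ ⟨y, _⟩ => isEmptyElim y
  choose! p hp using fun (σ : CWCell h k) (hσ : (K ∩ cwOpenCell h σ).Nonempty) => hσ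
  refine Set.Finite.of_finite_image (f := p) (finite_of_finite_inter_cwOpenCell h hK hKC ?_ ?_) ?_
  · rintro _ ⟨σ, hσ, rfl⟩
    exact (hp σ hσ).1
  · refine fun l τ => Set.Subsingleton.finite ?_
    rintro _ ⟨⟨σ, hσ, rfl⟩, h1⟩ _ ⟨⟨σ', hσ', rfl⟩, h2⟩
    obtain rfl := dim_eq_of_mem_cwOpenCell h (hp σ hσ).2 h1
    rw [eq_of_mem_cwOpenCell h (hp σ hσ).2 h1, eq_of_mem_cwOpenCell h (hp σ' hσ').2 h2]
  · intro σ hσ τ hτ hst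
    have := (hp τ hτ).2
    rw [← hst] at this
    exact eq_of_mem_cwOpenCell h (hp σ hσ).2 this

/-- An open `k`-cell is open in the `k`-skeleton. -/
lemma isClosed_skeleton_diff_cwOpenCell (h : CWComplex C) {k : ℕ} (τ : CWCell h k) :
    IsClosed ((RelCWComplex.skeleton C (k : ℕ∞) : Set Y) \ cwOpenCell h τ) := by
  refine CWComplex.isClosed_of_disjoint_openCell_or_isClosed_inter_closedCell
    (sdiff_subset.trans (RelCWComplex.Subcomplex.subset_complex _)) fun n _ j => ?_
  rcases lt_or_ge k n with hkn | hkn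
  · exact Or.inl ((RelCWComplex.disjoint_skeleton_openCell (by exact_mod_cast hkn)).mono_left
      sdiff_subset)
  by_cases hj : (⟨n, j⟩ : Σ n, CWCell h n) = ⟨k, τ⟩
  · cases hj
    exact Or.inl disjoint_sdiff_left
  right
  rw [inter_eq_right.2]
  · exact RelCWComplex.isClosed_closedCell
  · refine subset_sdiff.2 ⟨(RelCWComplex.closedCell_subset_skeleton n j).trans
      (RelCWComplex.skeleton_mono (by exact_mod_cast hkn)), ?_⟩
    rw [← RelCWComplex.cellFrontier_union_openCell_eq_closedCell, disjoint_union_left]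
    exact ⟨(RelCWComplex.disjoint_skeletonLT_openCell (by exact_mod_cast hkn)).mono_left
      (RelCWComplex.cellFrontier_subset_skeletonLT n j), RelCWComplex.disjoint_openCell_of_ne hj⟩

/-- A connected set that is covered by open `k`-cells lies in a single one of them. -/
lemma subset_cwOpenCell_of_isPreconnected (h : CWComplex C) {k : ℕ} {P : Set Y}
    (hP : IsPreconnected P) (hcover : ∀ y ∈ P, ∃ σ : CWCell h k, y ∈ cwOpenCell h σ)
    {τ : CWCell h k} {y₀ : Y} (hy₀ : y₀ ∈ P) (hτ : y₀ ∈ cwOpenCell h τ) :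
    P ⊆ cwOpenCell h τ := by
  have hsk : ∀ σ : CWCell h k, cwOpenCell h σ ⊆ (RelCWComplex.skeleton C (k : ℕ∞) : Set Y) :=
    fun σ => RelCWComplex.openCell_subset_skeleton k σ
  -- on `P`, the open cell `τ` coincides with the closed cell
  have key := (isPreconnected_closed_iff.1 hP) (RelCWComplex.closedCell k τ)
    ((RelCWComplex.skeleton C (k : ℕ∞) : Set Y) \ cwOpenCell h τ)
    RelCWComplex.isClosed_closedCell (isClosed_skeleton_diff_cwOpenCell h τ) ?_
    ⟨y₀, hy₀, RelCWComplex.openCell_subset_closedCell k τ hτ⟩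
  · by_contra hne
    obtain ⟨y, hyP, hy⟩ := not_subset.1 hne
    obtain ⟨σ, hσ⟩ := hcover y hyP
    obtain ⟨z, hzP, hzτ, -, hz⟩ := key ⟨y, hyP, hsk σ hσ, hy⟩
    obtain ⟨ρ, hρ⟩ := hcover z hzP
    rw [← RelCWComplex.cellFrontier_union_openCell_eq_closedCell] at hzτ
    rcases hzτ with hzτ | hzτ
    · exact disjoint_left.1 (RelCWComplex.disjoint_skeletonLT_openCell (C := C) (n := k) (j := ρ)
        le_rfl) (RelCWComplex.cellFrontier_subset_skeletonLT k τ hzτ) hρ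
    · exact hz hzτ
  · intro y hy
    obtain ⟨σ, hσ⟩ := hcover y hy
    by_cases hyτ : y ∈ cwOpenCell h τ
    · exact Or.inl (RelCWComplex.openCell_subset_closedCell k τ hyτ)
    · exact Or.inr ⟨hsk σ hσ, hyτ⟩

end CWComplex

/-! ### Lifting cellular homeomorphisms to discs -/

namespace CombinatorialComplex

/-- Let `φ` be a continuous map on the closed disc, and let `h` lift `ψ` through `φ` on the
open disc. Then `h` has a limit at each boundary point `x` for which the fibre of `φ` over `ψ x` is
finite: the images under `h` of small convex neighbourhoods of `x` are connected, and they avoid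
small spheres around a cluster point because these spheres can be chosen disjoint from the fibre. -/
lemma exists_tendsto_of_finite_fibre {X : Type u} [TopologicalSpace X] [T2Space X] {n : ℕ}
    {h : (Fin n → ℝ) → (Fin n → ℝ)} {φ ψ : (Fin n → ℝ) → X}
    (hh : ContinuousOn h (ball 0 1)) (hmaps : MapsTo h (ball 0 1) (closedBall 0 1))
    (hφ : ContinuousOn φ (closedBall 0 1)) (hψ : ContinuousOn ψ (closedBall 0 1))
    (hcomm : ∀ x ∈ ball (0 : Fin n → ℝ) 1, φ (h x) = ψ x) {x : Fin n → ℝ}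
    (hx : x ∈ closedBall (0 : Fin n → ℝ) 1)
    (hfin : {z ∈ closedBall (0 : Fin n → ℝ) 1 | φ z = ψ x}.Finite) :
    ∃ z, Filter.Tendsto h (𝓝[ball 0 1] x) (𝓝 z) := by
  have hcl : x ∈ closure (ball (0 : Fin n → ℝ) 1) := by rwa [closure_ball _ one_ne_zero]
  have hne : (𝓝[ball (0 : Fin n → ℝ) 1] x).NeBot := mem_closure_iff_nhdsWithin_neBot.1 hcl
  obtain ⟨z, -, hz⟩ := (isCompact_closedBall (0 : Fin n → ℝ) 1)
    (f := Filter.map h (𝓝[ball 0 1] x)) (Filter.tendsto_principal.2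
      (Filter.eventually_of_mem self_mem_nhdsWithin hmaps))
  refine ⟨z, Metric.tendsto_nhds.2 fun ε hε => ?_⟩
  obtain ⟨r, ⟨hr0, hrε⟩, hr⟩ := ((Ioo_infinite hε).sdiff (hfin.image (dist · z))).nonempty
  have hS : IsCompact (sphere z r ∩ closedBall (0 : Fin n → ℝ) 1) :=
    (isCompact_sphere z r).inter_right isClosed_closedBall
  have hφS : IsClosed (φ '' (sphere z r ∩ closedBall (0 : Fin n → ℝ) 1)) :=
    (hS.image_of_continuousOn (hφ.mono inter_subset_right)).isClosed
  have hnot : ψ x ∉ φ '' (sphere z r ∩ closedBall (0 : Fin n → ℝ) 1) := by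
    rintro ⟨w, ⟨hw, hw'⟩, hwx⟩
    exact hr ⟨w, ⟨hw', hwx⟩, hw⟩
  have hev : ∀ᶠ y in 𝓝[ball 0 1] x, ψ y ∉ φ '' (sphere z r ∩ closedBall (0 : Fin n → ℝ) 1) :=
    ((hψ x hx).mono ball_subset_closedBall).eventually (hφS.isOpen_compl.mem_nhds hnot)
  obtain ⟨δ, hδ, hδsub⟩ := Metric.mem_nhdsWithin_iff.1 hev
  have hP : IsPreconnected (h '' (ball x δ ∩ ball 0 1)) :=
    (((convex_ball x δ).inter (convex_ball 0 1)).isPreconnected).image h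
      (hh.mono inter_subset_right)
  have hsub : h '' (ball x δ ∩ ball 0 1) ⊆ ball z r := by
    refine hP.subset_left_of_subset_union isOpen_ball
      (isClosed_closedBall (x := z) (ε := r)).isOpen_compl ?_ ?_ ?_
    · exact disjoint_compl_right.mono_left ball_subset_closedBall
    · rintro _ ⟨y, hy, rfl⟩
      have hys : h y ∉ sphere z r := fun hys =>
        hδsub hy ⟨h y, ⟨hys, hmaps hy.2⟩, hcomm y hy.2⟩
      rcases lt_trichotomy (dist (h y) z) r with hlt | heq | hgt
      · exact Or.inl hlt
      · exact (hys heq).elim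
      · exact Or.inr fun hle => (not_le.2 hgt) hle
    · rw [inter_comm]
      refine clusterPt_iff_nonempty.1 hz (ball_mem_nhds z hr0) (Filter.image_mem_map ?_)
      exact Filter.inter_mem (mem_nhdsWithin_of_mem_nhds (ball_mem_nhds x hδ)) self_mem_nhdsWithin
  filter_upwards [Filter.inter_mem (mem_nhdsWithin_of_mem_nhds (ball_mem_nhds x hδ))
    self_mem_nhdsWithin] with y hy
  exact lt_trans (hsub ⟨y, hy, rfl⟩) hrε

variable {X : Type u} [TopologicalSpace X] [T2Space X] [CombinatorialComplex X]

omit [T2Space X] in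
/-- Characteristic maps of a combinatorial complex have finite fibres. -/
lemma finite_fibre_cwMap {n : ℕ} (e : Cell X n) (y : X) :
    {z ∈ closedBall (0 : Fin n → ℝ) 1 | cwMap cw e z = y}.Finite := by
  have hball : {z ∈ ball (0 : Fin n → ℝ) 1 | cwMap cw e z = y}.Finite :=
    Set.Subsingleton.finite fun a ha b hb => injOn_cwMap cw e ha.1 hb.1 (ha.2.trans hb.2.symm)
  have hsphere : {z ∈ sphere (0 : Fin n → ℝ) 1 | cwMap cw e z = y}.Finite := by
    refine finite_of_finite_inter_cwOpenCell (boundaryCW e) (isCompact_sphere 0 1) le_rfl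
      (fun z hz => hz.1) fun k σ => Set.Subsingleton.finite ?_
    rintro _ ⟨ha, a, ha', rfl⟩ _ ⟨hb, b, hb', rfl⟩
    have h1 := map_face e σ a (ball_subset_closedBall ha')
    have h2 := map_face e σ b (ball_subset_closedBall hb')
    rw [injOn_cwMap cw (face e σ) ha' hb' (h1.symm.trans (ha.2.trans (hb.2.symm.trans h2)))]
  refine (hball.union hsphere).subset fun z hz => ?_
  rw [← ball_union_sphere] at hz
  exact hz.1.imp (fun h => ⟨h, hz.2⟩) fun h => ⟨h, hz.2⟩

/-- The homeomorphism `f` of `X` maps the open cell `e` onto the open cell `e'`. -/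
def Carries (f : X ≃ₜ X) {n : ℕ} (e e' : Cell X n) : Prop :=
  f '' cwOpenCell cw e = cwOpenCell cw e'

/-- A homeomorphism of `X` is cellular if it and its inverse map open cells onto open cells of the
same dimension. -/
structure IsCellular (f : X ≃ₜ X) : Prop where
  exists_carries {n : ℕ} (e : Cell X n) : ∃ e' : Cell X n, Carries f e e'
  exists_carries_symm {n : ℕ} (e : Cell X n) : ∃ e' : Cell X n, Carries f.symm e e'

omit [T2Space X] in
lemma IsCellular.symm {f : X ≃ₜ X} (hf : IsCellular f) : IsCellular f.symm :=
  ⟨hf.exists_carries_symm, hf.exists_carries⟩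

namespace Carries

variable {f : X ≃ₜ X} {n : ℕ} {e e' : Cell X n}

omit [T2Space X] in
lemma symm (hc : Carries f e e') : Carries f.symm e' e := by
  rw [Carries, ← hc]
  exact f.toEquiv.symm_image_image _

omit [T2Space X] in
lemma apply_mem (hc : Carries f e e') {y : X} (hy : y ∈ cwOpenCell cw e) :
    f y ∈ cwOpenCell cw e' :=
  hc ▸ mem_image_of_mem f hy

omit [T2Space X] in
lemma right_unique {e'' : Cell X n} (hc : Carries f e e') (hc' : Carries f e e'') : e' = e'' :=
  eq_of_mem_cwOpenCell cw
    (hc.apply_mem (mem_image_of_mem _ (mem_ball_self one_pos)))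
    (hc'.apply_mem (mem_image_of_mem _ (mem_ball_self one_pos)))

end Carries

/-- The map between closed discs that lifts a homeomorphism `f` of `X` carrying the cell `e` to the
cell `e'`. On the open disc it is determined by the characteristic maps, and it is extended by
continuity to the boundary sphere. -/
noncomputable def discMap (f : X ≃ₜ X) {n : ℕ} (e e' : Cell X n) : (Fin n → ℝ) → (Fin n → ℝ) :=
  extendFrom (ball 0 1) fun x => (RelCWComplex.map n e').symm (f (cwMap cw e x))

namespace Carries

variable {f : X ≃ₜ X} {n : ℕ} {e e' : Cell X n}

omit [T2Space X] in
lemma lift_mem_ball (hc : Carries f e e') {x : Fin n → ℝ} (hx : x ∈ ball 0 1) :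
    (RelCWComplex.map n e').symm (f (cwMap cw e x)) ∈ ball 0 1 ∧
      cwMap cw e' ((RelCWComplex.map n e').symm (f (cwMap cw e x))) = f (cwMap cw e x) := by
  obtain ⟨z, hz, hzx⟩ := hc.apply_mem (mem_image_of_mem (cwMap cw e) hx)
  have hz' : z ∈ (RelCWComplex.map n e').source := by rwa [RelCWComplex.source_eq]
  rw [← hzx, (RelCWComplex.map n e').left_inv hz']
  exact ⟨hz, rfl⟩

omit [T2Space X] in
lemma continuousOn_lift (hc : Carries f e e') :
    ContinuousOn (fun x => (RelCWComplex.map n e').symm (f (cwMap cw e x))) (ball 0 1) := by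
  refine (RelCWComplex.continuousOn_symm n e').comp
    (f.continuous.comp_continuousOn ((continuousOn_cwMap cw e).mono ball_subset_closedBall)) ?_
  intro x hx
  obtain ⟨z, hz, hzx⟩ := hc.apply_mem (mem_image_of_mem (cwMap cw e) hx)
  rw [← RelCWComplex.source_eq n e'] at hz
  have := (RelCWComplex.map n e').map_source hz
  rwa [show RelCWComplex.map n e' z = f (cwMap cw e x) from hzx] at this

lemma tendsto_lift (hc : Carries f e e') {x : Fin n → ℝ} (hx : x ∈ closedBall 0 1) :
    ∃ z, Filter.Tendsto (fun x => (RelCWComplex.map n e').symm (f (cwMap cw e x)))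
      (𝓝[ball 0 1] x) (𝓝 z) :=
  exists_tendsto_of_finite_fibre hc.continuousOn_lift
    (fun _ hx => ball_subset_closedBall (hc.lift_mem_ball hx).1) (continuousOn_cwMap cw e')
    (f.continuous.comp_continuousOn (continuousOn_cwMap cw e))
    (fun _ hx => (hc.lift_mem_ball hx).2) hx (finite_fibre_cwMap e' _)

lemma continuousOn_discMap (hc : Carries f e e') :
    ContinuousOn (discMap f e e') (closedBall 0 1) :=
  continuousOn_extendFrom (by rw [closure_ball _ one_ne_zero]) fun _ hx => hc.tendsto_lift hx

omit [T2Space X] in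
lemma discMap_eq (hc : Carries f e e') {x : Fin n → ℝ} (hx : x ∈ ball 0 1) :
    discMap f e e' x = (RelCWComplex.map n e').symm (f (cwMap cw e x)) :=
  extendFrom_eq (subset_closure hx) (hc.continuousOn_lift x hx)

omit [T2Space X] in
lemma discMap_mem_ball (hc : Carries f e e') {x : Fin n → ℝ} (hx : x ∈ ball 0 1) :
    discMap f e e' x ∈ ball 0 1 := by
  rw [hc.discMap_eq hx]
  exact (hc.lift_mem_ball hx).1

lemma discMap_mem_closedBall (hc : Carries f e e') {x : Fin n → ℝ} (hx : x ∈ closedBall 0 1) :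
    discMap f e e' x ∈ closedBall 0 1 := by
  have := hc.continuousOn_discMap
  rw [← closure_ball _ one_ne_zero] at this hx ⊢
  exact (MapsTo.closure_of_continuousOn (fun _ hx => hc.discMap_mem_ball hx) this) hx

lemma cwMap_discMap (hc : Carries f e e') {x : Fin n → ℝ} (hx : x ∈ closedBall 0 1) :
    cwMap cw e' (discMap f e e' x) = f (cwMap cw e x) := by
  have h : EqOn (fun x => cwMap cw e' (discMap f e e' x)) (fun x => f (cwMap cw e x))
      (closedBall 0 1) := by
    refine EqOn.of_subset_closure (s := ball 0 1) ?_ ?_ ?_ ball_subset_closedBall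
      (by rw [closure_ball _ one_ne_zero])
    · intro x hx
      simp only [hc.discMap_eq hx, (hc.lift_mem_ball hx).2]
    · exact (continuousOn_cwMap cw e').comp hc.continuousOn_discMap
        fun x hx => hc.discMap_mem_closedBall hx
    · exact f.continuous.comp_continuousOn (continuousOn_cwMap cw e)
  exact h hx

lemma discMap_mem_sphere (hc : Carries f e e') {x : Fin n → ℝ} (hx : x ∈ sphere 0 1) :
    discMap f e e' x ∈ sphere 0 1 := by
  have hx' := sphere_subset_closedBall hx
  have := hc.discMap_mem_closedBall hx'
  rw [← ball_union_sphere] at this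
  refine this.resolve_left fun hball => ?_
  have h1 : f (cwMap cw e x) ∈ cwOpenCell cw e' :=
    hc.cwMap_discMap hx' ▸ mem_image_of_mem _ hball
  have h2 := hc.symm.apply_mem h1
  rw [f.symm_apply_apply] at h2
  exact cwMap_notMem_cwOpenCell cw e e hx h2

lemma discMap_symm_discMap (hc : Carries f e e') {x : Fin n → ℝ} (hx : x ∈ closedBall 0 1) :
    discMap f.symm e' e (discMap f e e' x) = x := by
  have h : EqOn (fun x => discMap f.symm e' e (discMap f e e' x)) id (closedBall 0 1) := by
    refine EqOn.of_subset_closure (s := ball 0 1) ?_ ?_ continuousOn_id ball_subset_closedBall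
      (by rw [closure_ball _ one_ne_zero])
    · intro x hx
      have hx1 := hc.discMap_mem_ball hx
      refine injOn_cwMap cw e (hc.symm.discMap_mem_ball hx1) hx ?_
      rw [hc.symm.cwMap_discMap (ball_subset_closedBall hx1),
        hc.cwMap_discMap (ball_subset_closedBall hx), f.symm_apply_apply, id]
    · exact hc.symm.continuousOn_discMap.comp hc.continuousOn_discMap
        fun x hx => hc.discMap_mem_closedBall hx
  exact h hx

end Carries

/-! ### Boundary spheres of a cell and of its translate -/

section BoundaryCell

variable {f : X ≃ₜ X} {n : ℕ} {e e' : Cell X n} {k : ℕ}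

omit [T2Space X] in
lemma cwMap_mem_closedDisc (σ : CWCell (boundaryCW e) k) {x : Fin k → ℝ} (hx : x ∈ closedBall 0 1) :
    cwMap (boundaryCW e) σ x ∈ closedBall (0 : Fin n → ℝ) 1 :=
  sphere_subset_closedBall (cwMap_mem (boundaryCW e) σ hx)

omit [T2Space X] in
lemma cwMap_mem_cwOpenCell_face {σ : CWCell (boundaryCW e) k} {z : Fin n → ℝ}
    (hz : z ∈ cwOpenCell (boundaryCW e) σ) : cwMap cw e z ∈ cwOpenCell cw (face e σ) := by
  obtain ⟨x, hx, rfl⟩ := hz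
  rw [map_face e σ x (ball_subset_closedBall hx)]
  exact mem_image_of_mem _ hx

/-- The lift of a cellular homeomorphism to closed discs maps each open cell of the boundary sphere
into an open cell of the same dimension: its image is connected, and it is covered by open cells
whose images in `X` have the right dimension. -/
lemma exists_mapsTo_discMap (hf : IsCellular f) (hc : Carries f e e')
    (σ : CWCell (boundaryCW e) k) : ∃ τ : CWCell (boundaryCW e') k,
      MapsTo (discMap f e e') (cwOpenCell (boundaryCW e) σ) (cwOpenCell (boundaryCW e') τ) := by
  have hsub : cwOpenCell (boundaryCW e) σ ⊆ sphere 0 1 := by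
    rintro _ ⟨x, hx, rfl⟩
    exact cwMap_mem (boundaryCW e) σ (ball_subset_closedBall hx)
  have hpre : IsPreconnected (discMap f e e' '' cwOpenCell (boundaryCW e) σ) := by
    refine IsPreconnected.image ?_ _ (hc.continuousOn_discMap.mono
      (hsub.trans sphere_subset_closedBall))
    exact (convex_ball 0 1).isPreconnected.image _
      ((continuousOn_cwMap (boundaryCW e) σ).mono ball_subset_closedBall)
  have hcover : ∀ y ∈ discMap f e e' '' cwOpenCell (boundaryCW e) σ,
      ∃ τ : CWCell (boundaryCW e') k, y ∈ cwOpenCell (boundaryCW e') τ := by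
    rintro _ ⟨x, hx, rfl⟩
    obtain ⟨l, τ, hτ⟩ := exists_mem_cwOpenCell (boundaryCW e') (hc.discMap_mem_sphere (hsub hx))
    obtain ⟨s, hs⟩ := hf.exists_carries (face e σ)
    have h1 := cwMap_mem_cwOpenCell_face hτ
    rw [hc.cwMap_discMap (sphere_subset_closedBall (hsub hx))] at h1
    obtain rfl := dim_eq_of_mem_cwOpenCell cw (hs.apply_mem (cwMap_mem_cwOpenCell_face hx)) h1
    exact ⟨τ, hτ⟩
  have h0 : cwMap (boundaryCW e) σ 0 ∈ cwOpenCell (boundaryCW e) σ :=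
    mem_image_of_mem _ (mem_ball_self one_pos)
  obtain ⟨τ, hτ⟩ := hcover _ (mem_image_of_mem _ h0)
  exact ⟨τ, fun x hx => subset_cwOpenCell_of_isPreconnected (boundaryCW e') hpre hcover
    (mem_image_of_mem _ h0) hτ (mem_image_of_mem _ hx)⟩

/-- The cell of the boundary sphere of `e'` onto which the lift of `f` maps a cell of the boundary
sphere of `e`. -/
noncomputable def boundaryCell (hf : IsCellular f) (hc : Carries f e e')
    (σ : CWCell (boundaryCW e) k) : CWCell (boundaryCW e') k :=
  (exists_mapsTo_discMap hf hc σ).choose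

lemma mapsTo_boundaryCell (hf : IsCellular f) (hc : Carries f e e')
    (σ : CWCell (boundaryCW e) k) :
    MapsTo (discMap f e e') (cwOpenCell (boundaryCW e) σ)
      (cwOpenCell (boundaryCW e') (boundaryCell hf hc σ)) :=
  (exists_mapsTo_discMap hf hc σ).choose_spec

lemma boundaryCell_symm_boundaryCell (hf : IsCellular f) (hc : Carries f e e')
    (σ : CWCell (boundaryCW e) k) :
    boundaryCell hf.symm hc.symm (boundaryCell hf hc σ) = σ := by
  have h0 : cwMap (boundaryCW e) σ 0 ∈ cwOpenCell (boundaryCW e) σ :=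
    mem_image_of_mem _ (mem_ball_self one_pos)
  have h1 := mapsTo_boundaryCell hf.symm hc.symm _ (mapsTo_boundaryCell hf hc σ h0)
  rw [hc.discMap_symm_discMap (cwMap_mem_closedDisc σ (mem_closedBall_self zero_le_one))] at h1
  exact eq_of_mem_cwOpenCell _ h1 h0

lemma boundaryCell_bijective (hf : IsCellular f) (hc : Carries f e e') :
    Function.Bijective (boundaryCell (k := k) hf hc) :=
  Function.bijective_iff_has_inverse.2 ⟨boundaryCell hf.symm hc.symm,
    boundaryCell_symm_boundaryCell hf hc, boundaryCell_symm_boundaryCell hf.symm hc.symm⟩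

lemma carries_face (hf : IsCellular f) (hc : Carries f e e') (σ : CWCell (boundaryCW e) k) :
    Carries f (face e σ) (face e' (boundaryCell hf hc σ)) := by
  have h0 : cwMap (boundaryCW e) σ 0 ∈ cwOpenCell (boundaryCW e) σ :=
    mem_image_of_mem _ (mem_ball_self one_pos)
  obtain ⟨s, hs⟩ := hf.exists_carries (face e σ)
  have h1 := cwMap_mem_cwOpenCell_face (mapsTo_boundaryCell hf hc σ h0)
  rw [hc.cwMap_discMap (cwMap_mem_closedDisc σ (mem_closedBall_self zero_le_one))] at h1
  rwa [← eq_of_mem_cwOpenCell cw (hs.apply_mem (cwMap_mem_cwOpenCell_face h0)) h1]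

omit [T2Space X] in
lemma face_subface (σ : CWCell (boundaryCW e) k) {j : ℕ}
    (τ : CWCell (boundaryCW (face e σ)) j) :
    face e (subface e σ τ) = face (face e σ) τ := by
  have h0 : (0 : Fin j → ℝ) ∈ closedBall (0 : Fin j → ℝ) 1 := mem_closedBall_self zero_le_one
  have h1 : cwMap cw (face e (subface e σ τ)) 0 = cwMap cw (face (face e σ) τ) 0 := by
    rw [← map_face e _ 0 h0, ← map_face _ τ 0 h0, ← map_subface e σ τ 0 h0,
      map_face e σ _ (cwMap_mem_closedDisc τ h0)]
  refine eq_of_mem_cwOpenCell cw (y := cwMap cw (face e (subface e σ τ)) 0)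
    (mem_image_of_mem _ (mem_ball_self one_pos)) ?_
  rw [h1]
  exact mem_image_of_mem _ (mem_ball_self one_pos)

/-- The lifts of `f` to the discs of `e` and of a cell `σ` of its boundary sphere are
compatible with the characteristic maps of `σ` and of its translate. -/
lemma discMap_cwMap (hf : IsCellular f) (hc : Carries f e e') (σ : CWCell (boundaryCW e) k)
    {x : Fin k → ℝ} (hx : x ∈ closedBall 0 1) :
    discMap f e e' (cwMap (boundaryCW e) σ x) = cwMap (boundaryCW e') (boundaryCell hf hc σ)
      (discMap f (face e σ) (face e' (boundaryCell hf hc σ)) x) := by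
  have hc' := carries_face hf hc σ
  have h : EqOn (fun x => discMap f e e' (cwMap (boundaryCW e) σ x))
      (fun x => cwMap (boundaryCW e') (boundaryCell hf hc σ)
        (discMap f (face e σ) (face e' (boundaryCell hf hc σ)) x)) (closedBall 0 1) := by
    refine EqOn.of_subset_closure (s := ball 0 1) ?_ ?_ ?_ ball_subset_closedBall
      (by rw [closure_ball _ one_ne_zero])
    · intro x hx
      -- both points lie in one open cell of the sphere, on which the attaching map is injective
      obtain ⟨w, hw, hwx⟩ := mapsTo_boundaryCell hf hc σ (mem_image_of_mem _ hx)
      have hxc := ball_subset_closedBall hx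
      have h1 := hc.cwMap_discMap (cwMap_mem_closedDisc σ hxc)
      rw [← hwx, map_face e' _ w (ball_subset_closedBall hw), map_face e σ x hxc,
        ← hc'.cwMap_discMap hxc] at h1
      simp only [← hwx, injOn_cwMap cw _ hw (hc'.discMap_mem_ball hx) h1]
    · exact hc.continuousOn_discMap.comp (continuousOn_cwMap _ σ) fun _ hx =>
        cwMap_mem_closedDisc σ hx
    · exact (continuousOn_cwMap _ _).comp hc'.continuousOn_discMap
        fun x hx => hc'.discMap_mem_closedBall hx
  exact h hx

lemma boundaryCell_subface (hf : IsCellular f) (hc : Carries f e e')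
    (σ : CWCell (boundaryCW e) k) {j : ℕ} (τ : CWCell (boundaryCW (face e σ)) j) :
    boundaryCell hf hc (subface e σ τ) =
      subface e' (boundaryCell hf hc σ) (boundaryCell hf (carries_face hf hc σ) τ) := by
  have h0 : (0 : Fin j → ℝ) ∈ ball (0 : Fin j → ℝ) 1 := mem_ball_self one_pos
  have h0' := ball_subset_closedBall h0
  have h1 := mapsTo_boundaryCell hf hc (subface e σ τ) (mem_image_of_mem _ h0)
  rw [← map_subface e σ τ 0 h0', discMap_cwMap hf hc σ (cwMap_mem_closedDisc τ h0')] at h1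
  refine eq_of_mem_cwOpenCell _ h1 ?_
  obtain ⟨w, hw, hwx⟩ := mapsTo_boundaryCell hf (carries_face hf hc σ) τ (mem_image_of_mem _ h0)
  rw [← hwx, map_subface e' _ _ w (ball_subset_closedBall hw)]
  exact mem_image_of_mem _ hw

end BoundaryCell

end CombinatorialComplex

/-! ### Signed permutations of a basis -/

section SignedMap

variable {ι κ : Type*}

/-- The linear map that sends the basis vector `i` to `s i` times the basis vector `β i`. -/
noncomputable def signedMap (β : ι → κ) (s : ι → ℤ) : (ι →₀ ℤ) →ₗ[ℤ] (κ →₀ ℤ) :=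
  Finsupp.linearCombination ℤ fun i => Finsupp.single (β i) (s i)

lemma signedMap_single (β : ι → κ) (s : ι → ℤ) (i : ι) (a : ℤ) :
    signedMap β s (Finsupp.single i a) = Finsupp.single (β i) (a * s i) := by
  simp [signedMap, -Finsupp.single_mul]

lemma signedMap_apply {β : ι → κ} (hβ : Function.Injective β) (s : ι → ℤ) (c : ι →₀ ℤ) (i : ι) :
    signedMap β s c (β i) = c i * s i := by
  induction c using Finsupp.induction_linear with
  | zero => simp
  | add a b ha hb => simp [ha, hb, add_mul]
  | single j a =>
    by_cases hij : j = i
    · subst hij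
      rw [signedMap_single, Finsupp.single_eq_same, Finsupp.single_eq_same]
    · rw [signedMap_single, Finsupp.single_eq_of_ne (hβ.ne (Ne.symm hij)),
        Finsupp.single_eq_of_ne (Ne.symm hij), zero_mul]

lemma signedMap_injective {β : ι → κ} (hβ : Function.Injective β) {s : ι → ℤ}
    (hs : ∀ i, s i * s i = 1) : Function.Injective (signedMap β s) := by
  intro a b hab
  ext i
  have h := DFunLike.congr_fun hab (β i)
  rw [signedMap_apply hβ, signedMap_apply hβ] at h
  exact mul_right_cancel₀ (fun h0 => by simpa [h0] using hs i) h

lemma signedMap_surjective {β : ι → κ} (hβ : Function.Surjective β) {s : ι → ℤ}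
    (hs : ∀ i, s i * s i = 1) : Function.Surjective (signedMap β s) := by
  intro c
  induction c using Finsupp.induction_linear with
  | zero => exact ⟨0, map_zero _⟩
  | add a b ha hb =>
    obtain ⟨a', rfl⟩ := ha
    obtain ⟨b', rfl⟩ := hb
    exact ⟨a' + b', map_add _ _ _⟩
  | single k a =>
    obtain ⟨i, rfl⟩ := hβ k
    exact ⟨Finsupp.single i (a * s i), by rw [signedMap_single, mul_assoc, hs, mul_one]⟩

lemma sum_natAbs_signedMap {β : ι → κ} (hβ : Function.Injective β) {s : ι → ℤ}
    (hs : ∀ i, s i * s i = 1) (c : ι →₀ ℤ) :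
    ((signedMap β s c).sum fun _ a => a.natAbs) = c.sum fun _ a => a.natAbs := by
  classical
  have hsub : (signedMap β s c).support ⊆ c.support.image β := by
    refine Finsupp.support_sum.trans fun k hk => ?_
    obtain ⟨i, hi, hk⟩ := Finset.mem_biUnion.1 hk
    refine Finset.mem_image.2 ⟨i, hi, ?_⟩
    by_contra hne
    simp [hne] at hk
  rw [Finsupp.sum_of_support_subset _ hsub _ fun _ _ => rfl, Finset.sum_image hβ.injOn]
  refine Finset.sum_congr rfl fun i _ => ?_
  rw [signedMap_apply hβ, Int.natAbs_mul, Int.isUnit_iff_natAbs_eq.1 (.of_mul_eq_one _ (hs i)),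
    mul_one]

end SignedMap

/-- If `T` is surjective and identifies membership in the cyclic groups `Z` and `Z'`, then it maps a
generator of `Z` to a generator of `Z'`, which is unique up to sign. -/
lemma eq_or_eq_neg_of_span_singleton {M N : Type*} [AddCommGroup M] [AddCommGroup N]
    [Module.IsTorsionFree ℤ N] (T : M →ₗ[ℤ] N) (hT : Function.Surjective T) {Z : Submodule ℤ M}
    {Z' : Submodule ℤ N} (hZ : ∀ c, T c ∈ Z' ↔ c ∈ Z) {a : M} {a' : N}
    (ha : Submodule.span ℤ {a} = Z) (ha' : Submodule.span ℤ {a'} = Z') :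
    a' = T a ∨ a' = -T a := by
  have h1 : T a ∈ Submodule.span ℤ {a'} := by
    rw [ha', hZ, ← ha]
    exact Submodule.mem_span_singleton_self a
  obtain ⟨x, hx⟩ := Submodule.mem_span_singleton.1 h1
  obtain ⟨c, rfl⟩ := hT a'
  have h2 : c ∈ Submodule.span ℤ {a} := by
    rw [ha, ← hZ, ← ha']
    exact Submodule.mem_span_singleton_self _
  obtain ⟨y, rfl⟩ := Submodule.mem_span_singleton.1 h2
  rw [map_smul] at hx ⊢
  have h3 : (x * y - 1) • T a = 0 := by rw [sub_smul, mul_smul, hx, one_smul, sub_self]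
  rcases smul_eq_zero.1 h3 with h | h
  · rcases Int.eq_one_or_neg_one_of_mul_eq_one' (sub_eq_zero.1 h) with ⟨-, rfl⟩ | ⟨-, rfl⟩ <;> simp
  · simp [h]

/-! ### Chain maps induced by cellular homeomorphisms -/

namespace CombinatorialComplex

variable {X : Type u} [TopologicalSpace X] [T2Space X] [CombinatorialComplex X]
  {f : X ≃ₜ X} {n : ℕ} {e e' : Cell X n} {k : ℕ}

/-- The isomorphism between the cellular chains of the boundary spheres of `e` and of its
translate `e'`, when `f` changes the orientations of the `k`-cells of `X` by the signs `s`. -/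
noncomputable def sphereChainMap (s : Cell X k → ℤ) (hf : IsCellular f) (hc : Carries f e e') :
    SphereChain e k →ₗ[ℤ] SphereChain e' k :=
  signedMap (boundaryCell hf hc) fun σ => s (face e σ)

lemma mapDomain_subface_sphereChainMap (s : Cell X k → ℤ) (hf : IsCellular f)
    (hc : Carries f e e') {j : ℕ} (σ : CWCell (boundaryCW e) j) (c : SphereChain (face e σ) k) :
    Finsupp.mapDomain (subface e' (boundaryCell hf hc σ))
        (sphereChainMap s hf (carries_face hf hc σ) c) =
      sphereChainMap s hf hc (Finsupp.mapDomain (subface e σ) c) := by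
  induction c using Finsupp.induction_linear with
  | zero => simp
  | add a b ha hb => simp [Finsupp.mapDomain_add, ha, hb]
  | single τ a =>
    simp only [sphereChainMap, signedMap_single, Finsupp.mapDomain_single, boundaryCell_subface,
      face_subface]

/-- If `f` maps fundamental cycles to fundamental cycles up to the signs `s'`, then it induces
chain maps between boundary spheres. -/
lemma sphereBoundary_sphereChainMap {ω : ∀ r : Cell X (k + 1), SphereChain r k}
    {s : Cell X k → ℤ} {s' : Cell X (k + 1) → ℤ} (hs' : ∀ r, s' r * s' r = 1) (hf : IsCellular f)
    (hω : ∀ (r r' : Cell X (k + 1)) (hc : Carries f r r'),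
      ω r' = s' r • sphereChainMap s hf hc (ω r))
    (hc : Carries f e e') (c : SphereChain e (k + 1)) :
    sphereBoundary ω e' (sphereChainMap s' hf hc c) =
      sphereChainMap s hf hc (sphereBoundary ω e c) := by
  induction c using Finsupp.induction_linear with
  | zero => simp
  | add a b ha hb => simp [ha, hb]
  | single σ a =>
    simp only [sphereChainMap, signedMap_single]
    simp only [sphereBoundary, Finsupp.linearCombination_single, map_smul]
    rw [hω _ _ (carries_face hf hc σ), Finsupp.mapDomain_smul, mapDomain_subface_sphereChainMap,
      smul_smul, mul_assoc, hs', mul_one]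
    rfl

/-- The cell onto which a cellular homeomorphism maps a given cell. -/
noncomputable def cellMap (hf : IsCellular f) (e : Cell X n) : Cell X n :=
  (hf.exists_carries e).choose

omit [T2Space X] in
lemma carries_cellMap (hf : IsCellular f) (e : Cell X n) : Carries f e (cellMap hf e) :=
  (hf.exists_carries e).choose_spec

omit [T2Space X] in
lemma Carries.eq_cellMap (hf : IsCellular f) (hc : Carries f e e') : e' = cellMap hf e :=
  hc.right_unique (carries_cellMap hf e)

omit [T2Space X] in
lemma cellMap_bijective (hf : IsCellular f) : Function.Bijective (cellMap (n := n) hf) := by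
  refine Function.bijective_iff_has_inverse.2 ⟨cellMap hf.symm, fun e => ?_, fun e => ?_⟩
  · exact ((carries_cellMap hf e).symm.eq_cellMap hf.symm).symm
  · exact ((carries_cellMap hf.symm e).symm.eq_cellMap hf).symm

open Classical in
/-- The sign by which a cellular homeomorphism changes the orientation of a cell. It is defined by
recursion on the dimension, as comparing fundamental cycles of boundary spheres requires the signs
of the cells of these spheres. -/
noncomputable def orientationSign (o : Orientation X) (hf : IsCellular f) :
    (n : ℕ) → Cell X n → ℤ
  | 0 => fun _ => 1
  | n + 1 => fun e =>
    if o.fundCycle n (cellMap hf e) =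
        sphereChainMap (orientationSign o hf n) hf (carries_cellMap hf e) (o.fundCycle n e)
      then 1 else -1

lemma orientationSign_mul_self (o : Orientation X) (hf : IsCellular f) (e : Cell X n) :
    orientationSign o hf n e * orientationSign o hf n e = 1 := by
  cases n with
  | zero => rfl
  | succ n =>
    simp only [orientationSign]
    split_ifs <;> norm_num

lemma fundCycle_eq_of_mem_sphereCycles_iff (o : Orientation X) (hf : IsCellular f)
    {e e' : Cell X (n + 1)} {hc : Carries f e e'}
    (hcyc : ∀ c : SphereChain e n, sphereChainMap (orientationSign o hf n) hf hc c ∈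
      sphereCycles o.fundCycle e' n ↔ c ∈ sphereCycles o.fundCycle e n) :
    o.fundCycle n e' = orientationSign o hf (n + 1) e •
      sphereChainMap (orientationSign o hf n) hf hc (o.fundCycle n e) := by
  obtain rfl := hc.eq_cellMap hf
  have h := eq_or_eq_neg_of_span_singleton _
    (signedMap_surjective (boundaryCell_bijective hf hc).2
      fun σ => orientationSign_mul_self o hf (face e σ)) hcyc
    (o.span_fundCycle n e) (o.span_fundCycle n _)
  simp only [orientationSign]
  split_ifs with h1
  · rw [one_smul]
    exact h1
  · rw [neg_smul, one_smul]
    exact h.resolve_left h1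

/-- A cellular homeomorphism maps fundamental cycles to fundamental cycles, up to sign. -/
lemma fundCycle_eq_of_carries (o : Orientation X) (hf : IsCellular f) (n : ℕ)
    {e e' : Cell X (n + 1)} (hc : Carries f e e') :
    o.fundCycle n e' = orientationSign o hf (n + 1) e •
      sphereChainMap (orientationSign o hf n) hf hc (o.fundCycle n e) := by
  induction n with
  | zero =>
    have hcyc : ∀ c : SphereChain e 0,
        sphereChainMap (orientationSign o hf 0) hf hc c ∈
          sphereCycles o.fundCycle e' 0 ↔ c ∈ sphereCycles o.fundCycle e 0 := by
      intro c
      simp only [sphereCycles, LinearMap.mem_ker]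
      suffices h : (Finsupp.linearCombination ℤ fun _ => (1 : ℤ)) ∘ₗ
          sphereChainMap (orientationSign o hf 0) hf hc =
          Finsupp.linearCombination ℤ fun _ => (1 : ℤ) by
        rw [← h]; rfl
      ext σ
      simp [sphereChainMap, orientationSign, signedMap_single]
    exact fundCycle_eq_of_mem_sphereCycles_iff o hf hcyc
  | succ n ih =>
    have hcyc : ∀ c : SphereChain e (n + 1),
        sphereChainMap (orientationSign o hf (n + 1)) hf hc c ∈
          sphereCycles o.fundCycle e' (n + 1) ↔ c ∈ sphereCycles o.fundCycle e (n + 1) := by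
      intro c
      simp only [sphereCycles, LinearMap.mem_ker]
      rw [sphereBoundary_sphereChainMap (orientationSign_mul_self o hf) hf
        (fun _ _ hc => ih hc) hc]
      exact map_eq_zero_iff _ (signedMap_injective (boundaryCell_bijective hf hc).1
        fun σ => orientationSign_mul_self o hf (face e σ))
    exact fundCycle_eq_of_mem_sphereCycles_iff o hf hcyc

/-- The automorphism of the cellular chain group induced by a cellular homeomorphism. -/
noncomputable def chainMap (o : Orientation X) (hf : IsCellular f) (n : ℕ) :
    Chain X n →ₗ[ℤ] Chain X n :=
  signedMap (cellMap hf) (orientationSign o hf n)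

lemma chainMap_injective (o : Orientation X) (hf : IsCellular f) (n : ℕ) :
    Function.Injective (chainMap o hf n) :=
  signedMap_injective (cellMap_bijective hf).1 (orientationSign_mul_self o hf)

lemma chainMap_surjective (o : Orientation X) (hf : IsCellular f) (n : ℕ) :
    Function.Surjective (chainMap o hf n) :=
  signedMap_surjective (cellMap_bijective hf).2 (orientationSign_mul_self o hf)

lemma norm₁_chainMap (o : Orientation X) (hf : IsCellular f) (c : Chain X n) :
    norm₁ (chainMap o hf n c) = norm₁ c :=
  sum_natAbs_signedMap (cellMap_bijective hf).1 (orientationSign_mul_self o hf) c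

lemma chainMap_apply_cellMap_ne_zero (o : Orientation X) (hf : IsCellular f) {c : Chain X n} :
    chainMap o hf n c (cellMap hf e) ≠ 0 ↔ c e ≠ 0 := by
  rw [chainMap, signedMap_apply (cellMap_bijective hf).1]
  have h : orientationSign o hf n e ≠ 0 := fun h0 => by
    simpa [h0] using orientationSign_mul_self o hf e
  simp [h]

lemma boundary_chainMap (o : Orientation X) (hf : IsCellular f) (c : Chain X (n + 1)) :
    boundary o n (chainMap o hf (n + 1) c) = chainMap o hf n (boundary o n c) := by
  have hface : ∀ (e : Cell X (n + 1)) (b : SphereChain e n),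
      Finsupp.mapDomain (face (cellMap hf e))
          (sphereChainMap (orientationSign o hf n) hf (carries_cellMap hf e) b) =
        chainMap o hf n (Finsupp.mapDomain (face e) b) := by
    intro e b
    induction b using Finsupp.induction_linear with
    | zero => simp
    | add a b ha hb => simp [Finsupp.mapDomain_add, ha, hb]
    | single σ a =>
      simp only [sphereChainMap, chainMap, signedMap_single, Finsupp.mapDomain_single,
        (carries_face hf (carries_cellMap hf e) σ).eq_cellMap hf]
  induction c using Finsupp.induction_linear with
  | zero => simp
  | add a b ha hb => simp [ha, hb]
  | single e a =>
    simp only [chainMap, signedMap_single]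
    simp only [boundary, Finsupp.linearCombination_single, map_smul]
    rw [fundCycle_eq_of_carries o hf n (carries_cellMap hf e), Finsupp.mapDomain_smul, hface,
      smul_smul, mul_assoc, orientationSign_mul_self, mul_one]
    rfl

end CombinatorialComplex

/-! ### Splitting cycles in a locally finite chain complex -/

section Splitting

variable {ι κ : Type*} (D : (ι →₀ ℤ) →ₗ[ℤ] (κ →₀ ℤ))

/-- The basis elements that can be joined to `E` by a chain of at most `k` steps between elements
whose boundaries have a common basis element in their supports. -/
def neighborhood (E : Set ι) : ℕ → Set ι
  | 0 => E
  | k + 1 => neighborhood E k ∪ {j | ∃ i ∈ neighborhood E k, ∃ a,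
      D (Finsupp.single i 1) a ≠ 0 ∧ D (Finsupp.single j 1) a ≠ 0}

variable {D}

lemma neighborhood_mono (E : Set ι) : Monotone (neighborhood D E) :=
  monotone_nat_of_le_succ fun _ => subset_union_left

lemma finite_neighborhood {E : Set ι} (hE : E.Finite)
    (hloc : ∀ i, {j | ∃ a, D (Finsupp.single i 1) a ≠ 0 ∧ D (Finsupp.single j 1) a ≠ 0}.Finite)
    (k : ℕ) : (neighborhood D E k).Finite := by
  induction k with
  | zero => exact hE
  | succ k ih =>
    refine ih.union ((ih.biUnion fun i _ => hloc i).subset ?_)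
    rintro j ⟨i, hi, hj⟩
    exact mem_biUnion hi hj

lemma exists_single_of_apply_ne_zero {c : ι →₀ ℤ} {a : κ} (h : D c a ≠ 0) :
    ∃ i, c i ≠ 0 ∧ D (Finsupp.single i 1) a ≠ 0 := by
  by_contra! hne
  refine h ?_
  have hc : D c = c.sum fun i x => x • D (Finsupp.single i 1) := by
    conv_lhs => rw [← Finsupp.sum_single c]
    rw [map_finsuppSum]
    refine Finsupp.sum_congr fun i _ => ?_
    rw [← map_smul, Finsupp.smul_single_one]
  rw [hc, Finsupp.sum, Finsupp.finsetSum_apply]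
  exact Finset.sum_eq_zero fun i hi => by
    rw [Finsupp.smul_apply, hne i (Finsupp.mem_support_iff.1 hi), smul_zero]

/-- If no element of `S` shares a piece of boundary with an element of the support of a cycle
outside `S`, then the part of the cycle in `S` is a cycle. -/
lemma filter_mem_ker {c : ι →₀ ℤ} (hc : D c = 0) (S : Set ι) [DecidablePred (· ∈ S)]
    (hS : ∀ i ∈ S, ∀ j ∉ S, c j ≠ 0 → ∀ a, D (Finsupp.single i 1) a ≠ 0 →
      D (Finsupp.single j 1) a = 0) :
    D (c.filter (· ∈ S)) = 0 ∧ D (c.filter (· ∉ S)) = 0 := by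
  have hsum : D (c.filter (· ∈ S)) + D (c.filter (· ∉ S)) = 0 := by
    rw [← map_add, Finsupp.filter_add_filter_not, hc]
  suffices h : D (c.filter (· ∈ S)) = 0 by
    rw [h, zero_add] at hsum
    exact ⟨h, hsum⟩
  ext a
  by_contra hne
  have hne' : D (c.filter (· ∉ S)) a ≠ 0 := by
    intro h0
    have := DFunLike.congr_fun hsum a
    rw [Finsupp.add_apply, h0, add_zero] at this
    exact hne this
  obtain ⟨i, hi, hia⟩ := exists_single_of_apply_ne_zero hne
  obtain ⟨j, hj, hja⟩ := exists_single_of_apply_ne_zero hne'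
  have hiS : i ∈ S := by
    by_contra h
    exact hi (Finsupp.filter_apply_neg _ _ h)
  have hjS : j ∉ S := by
    by_contra h
    exact hj (Finsupp.filter_apply_neg (· ∉ S) _ (not_not.2 h))
  rw [Finsupp.filter_apply_pos (· ∉ S) _ hjS] at hj
  exact hja (hS i hiS j hjS hj a hia)

lemma card_support_le_sum_natAbs (c : ι →₀ ℤ) : c.support.card ≤ c.sum fun _ a => a.natAbs := by
  rw [Finsupp.sum, Finset.card_eq_sum_ones]
  exact Finset.sum_le_sum fun i hi =>
    Nat.one_le_iff_ne_zero.2 (Int.natAbs_ne_zero.2 (Finsupp.mem_support_iff.1 hi))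

/-- The part of the support of `c` in the `k`-neighborhood of `E` cannot grow with `k` forever. -/
lemma exists_inter_neighborhood_succ_subset (E : Set ι) {c : ι →₀ ℤ} {m : ℕ}
    (hm : (c.sum fun _ a => a.natAbs) ≤ m) :
    ∃ k ≤ m, ∀ j ∈ neighborhood D E (k + 1), c j ≠ 0 → j ∈ neighborhood D E k := by
  classical
  by_contra! hne
  have hcard : ∀ k ≤ m + 1, k ≤ (c.support.filter (· ∈ neighborhood D E k)).card := by
    intro k
    induction k with
    | zero => exact fun _ => Nat.zero_le _
    | succ k ih =>
      intro hk
      obtain ⟨j, hj, hcj, hj'⟩ := hne k (by omega)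
      refine (ih (by omega)).trans_lt (Finset.card_lt_card ?_)
      refine Finset.ssubset_iff_of_subset (fun i hi => ?_) |>.2 ⟨j, ?_, ?_⟩
      · rw [Finset.mem_filter] at hi ⊢
        exact ⟨hi.1, neighborhood_mono E k.le_succ hi.2⟩
      · exact Finset.mem_filter.2 ⟨Finsupp.mem_support_iff.2 hcj, hj⟩
      · exact fun h => hj' (Finset.mem_filter.1 h).2
  have h1 := hcard (m + 1) le_rfl
  have h2 := Finset.card_filter_le c.support (· ∈ neighborhood D E (m + 1))
  have h3 := card_support_le_sum_natAbs c
  omega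

lemma natAbs_apply_le_sum (c : ι →₀ ℤ) (i : ι) :
    (c i).natAbs ≤ c.sum fun _ a => a.natAbs := by
  by_cases hi : i ∈ c.support
  · exact Finset.single_le_sum (f := fun i => (c i).natAbs) (fun _ _ => Nat.zero_le _) hi
  · simp [Finsupp.notMem_support_iff.1 hi]

lemma finite_setOf_support_subset {S : Set ι} (hS : S.Finite) (m : ℕ) :
    {c : ι →₀ ℤ | ↑c.support ⊆ S ∧ (c.sum fun _ a => a.natAbs) ≤ m}.Finite := by
  classical
  refine (hS.toFinset.finsupp fun _ => Finset.Icc (-(m : ℤ)) m).finite_toSet.subset ?_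
  rintro c ⟨hc, hm⟩
  refine Finset.mem_coe.2 (Finset.mem_finsupp_iff.2 ⟨fun i hi => hS.mem_toFinset.2 (hc hi), ?_⟩)
  intro i _
  have := (natAbs_apply_le_sum c i).trans hm
  rw [Finset.mem_Icc]
  omega

/-- Let `P c B` be a property of chains `c` which is monotone in `B`, additive, and true of
every cycle for some `B`. Suppose that boundaries overlap in a locally finite way and that every
nonzero cycle can be moved, preserving its `ℓ₁`-norm, so that its support meets a fixed finite set.
Then there is a `B` that works for all cycles of bounded `ℓ₁`-norm.

By induction on the norm: a cycle whose support meets the finite set `E` either is supported in a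
fixed finite neighborhood of `E`, and there are only finitely many such cycles, or splits into two
cycles of smaller norm. -/
theorem exists_bound_of_locally_finite {P : (ι →₀ ℤ) → ℕ → Prop}
    (hmono : ∀ c B B', B ≤ B' → P c B → P c B')
    (hadd : ∀ c c' B B', P c B → P c' B' → P (c + c') (B + B'))
    (hex : ∀ c, D c = 0 → ∃ B, P c B)
    (hloc : ∀ i, {j | ∃ a, D (Finsupp.single i 1) a ≠ 0 ∧ D (Finsupp.single j 1) a ≠ 0}.Finite)
    {E : Set ι} (hE : E.Finite)
    (hmove : ∀ (c : ι →₀ ℤ) (i : ι), D c = 0 → c i ≠ 0 → ∃ c' : ι →₀ ℤ, D c' = 0 ∧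
      ((c'.sum fun _ a => a.natAbs) = c.sum fun _ a => a.natAbs) ∧ (∃ j ∈ E, c' j ≠ 0) ∧
      ∀ B, P c' B → P c B) (m : ℕ) :
    ∃ B, ∀ c, D c = 0 → (c.sum fun _ a => a.natAbs) ≤ m → P c B := by
  classical
  have hsum0 : ∀ c : ι →₀ ℤ, c ≠ 0 → 0 < c.sum fun _ a => a.natAbs := fun c hc =>
    (Finset.card_pos.2 (Finsupp.support_nonempty_iff.2 hc)).trans_le
      (card_support_le_sum_natAbs c)
  induction m with
  | zero =>
    obtain ⟨B, hB⟩ := hex 0 (map_zero D)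
    refine ⟨B, fun c _ hc => ?_⟩
    by_cases h0 : c = 0
    · exact h0 ▸ hB
    · exact absurd (hsum0 c h0) (not_lt.2 hc)
  | succ m ih =>
    obtain ⟨B, hB⟩ := ih
    have hΦ := finite_setOf_support_subset
      (finite_neighborhood hE hloc (m + 1)) (m + 1)
    choose! b hb using hex
    obtain ⟨B₁, hB₁⟩ := (hΦ.image b).bddAbove
    have hsmall : ∀ c : ι →₀ ℤ, D c = 0 → ↑c.support ⊆ neighborhood D E (m + 1) →
        (c.sum fun _ a => a.natAbs) ≤ m + 1 → P c (B₁ + (B + B)) := fun c hc hcs hcm =>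
      hmono c _ _ ((hB₁ (mem_image_of_mem b ⟨hcs, hcm⟩)).trans (Nat.le_add_right _ _)) (hb c hc)
    refine ⟨B₁ + (B + B), fun c₀ hc₀ hcm₀ => ?_⟩
    by_cases h0 : c₀ = 0
    · subst h0
      exact hsmall 0 hc₀ (by simp) hcm₀
    obtain ⟨i, hi⟩ := Finsupp.ne_iff.1 h0
    obtain ⟨c, hc, hcm, ⟨j, hjE, hj⟩, hcB⟩ := hmove c₀ i hc₀ hi
    rw [← hcm] at hcm₀
    apply hcB
    obtain ⟨k, hk, hkS⟩ := exists_inter_neighborhood_succ_subset (D := D) E hcm₀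
    obtain ⟨h1, h2⟩ := filter_mem_ker hc (neighborhood D E k) fun i hi j hj hcj a hia => by
      by_contra hja
      exact hj (hkS j (Or.inr ⟨i, hi, a, hia, hja⟩) hcj)
    have hsplit := Finsupp.filter_add_filter_not c (· ∈ neighborhood D E k)
    have hnorm : ((c.filter (· ∈ neighborhood D E k)).sum fun _ a => a.natAbs) +
        ((c.filter (· ∉ neighborhood D E k)).sum fun _ a => a.natAbs) =
          c.sum fun _ a => a.natAbs := by
      rw [Finsupp.sum_filter_index, Finsupp.sum_filter_index, Finsupp.support_filter,
        Finsupp.support_filter]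
      exact Finset.sum_filter_add_sum_filter_not _ _ _
    have hpos : 0 < (c.filter (· ∈ neighborhood D E k)).sum fun _ a => a.natAbs := by
      refine hsum0 _ fun h => hj ?_
      rw [← Finsupp.filter_apply_pos (· ∈ neighborhood D E k) c
        (neighborhood_mono E (Nat.zero_le k) hjE), h, Finsupp.zero_apply]
    by_cases h3 : c.filter (· ∉ neighborhood D E k) = 0
    · refine hsmall c hc (fun i hi => neighborhood_mono E hk ?_) hcm₀
      by_contra hik
      refine Finsupp.mem_support_iff.1 hi ?_
      rw [← Finsupp.filter_apply_pos (· ∉ neighborhood D E k) c hik, h3, Finsupp.zero_apply]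
    · have hpos' := hsum0 _ h3
      rw [← hsplit]
      exact hmono _ _ _ (Nat.le_add_left _ _)
        (hadd _ _ _ _ (hB _ h1 (by omega)) (hB _ h2 (by omega)))

end Splitting

/-! ### Proper cocompact actions -/

namespace CombinatorialComplex

section Action

variable {X : Type u} [TopologicalSpace X] [CombinatorialComplex X]
  {G : Type v} [Group G] [MulAction G X]

/-- The homeomorphism of `X` by which `g` acts. -/
def IsCellularAction.homeomorph (hcell : IsCellularAction G X) (g : G) : X ≃ₜ X where
  toEquiv := MulAction.toPerm g
  continuous_toFun := hcell.continuous_smul g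
  continuous_invFun := hcell.continuous_smul g⁻¹

lemma IsCellularAction.isCellular (hcell : IsCellularAction G X) (g : G) :
    IsCellular (hcell.homeomorph g) where
  exists_carries e := hcell.map_openCell g _ e
  exists_carries_symm e := hcell.map_openCell g⁻¹ _ e

variable {K : RelCWComplex.Subcomplex (univ : Set X)}

/-- If the translates of `K` cover `X`, then every cell is a translate of a cell that meets `K`. -/
lemma IsCellularAction.exists_cellMap_inter_nonempty (hcell : IsCellularAction G X)
    (hcover : ⋃ g : G, (fun x : X => g • x) '' (K : Set X) = univ) {n : ℕ} (e : Cell X n) :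
    ∃ g : G, ((K : Set X) ∩ cwOpenCell cw (cellMap (hcell.isCellular g) e)).Nonempty := by
  have hmem : cwMap cw e 0 ∈ cwOpenCell cw e := mem_image_of_mem _ (mem_ball_self one_pos)
  obtain ⟨g, x, hx, hgx⟩ := mem_iUnion.1 (hcover.ge (mem_univ (cwMap cw e 0)))
  refine ⟨g⁻¹, x, hx, ?_⟩
  have h := (carries_cellMap (hcell.isCellular g⁻¹) e).apply_mem hmem
  rwa [← hgx, show hcell.homeomorph g⁻¹ ((fun x : X => g • x) x) = x from inv_smul_smul g x] at h

/-- For a proper action, a point lies in finitely many translates of a compact subcomplex. -/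
lemma IsProperAction.finite_setOf_mem_translate (hproper : IsProperAction G X)
    (hK : IsCompact (K : Set X)) (x : X) :
    {g : G | x ∈ (fun x : X => g • x) '' (K : Set X)}.Finite := by
  rcases Set.eq_empty_or_nonempty {g : G | x ∈ (fun x : X => g • x) '' (K : Set X)} with h | h
  · exact h ▸ finite_empty
  obtain ⟨g₀, y₀, hy₀, hgy₀⟩ := h
  refine ((hproper K hK).image (g₀ * ·)).subset ?_
  rintro g ⟨y, hy, hgy⟩
  refine ⟨g₀⁻¹ * g, ⟨y₀, hy₀, y, hy, ?_⟩, mul_inv_cancel_left g₀ g⟩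
  simp only at hgy hgy₀ ⊢
  rw [mul_smul, hgy, ← hgy₀, inv_smul_smul]

variable [T2Space X]

lemma Carries.closedCell_eq {f : X ≃ₜ X} {n : ℕ} {e e' : Cell X n} (hc : Carries f e e') :
    f '' RelCWComplex.closedCell n e = RelCWComplex.closedCell n e' := by
  rw [← RelCWComplex.closure_openCell_eq_closedCell, ← RelCWComplex.closure_openCell_eq_closedCell,
    f.image_closure]
  exact congrArg closure hc

/-- A combinatorial complex with a proper cocompact cellular action is locally finite. -/
lemma finite_setOf_mem_closedCell (hcell : IsCellularAction G X)
    (hproper : IsProperAction G X) (hK : IsCompact (K : Set X))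
    (hcover : ⋃ g : G, (fun x : X => g • x) '' (K : Set X) = univ) (n : ℕ) (x : X) :
    {e : Cell X n | x ∈ RelCWComplex.closedCell n e}.Finite := by
  have hE := finite_setOf_inter_cwOpenCell (cw (X := X)) hK (subset_univ _) n
  refine ((hproper.finite_setOf_mem_translate hK x).image2
    (fun g e => cellMap (hcell.isCellular g) e) hE).subset ?_
  intro e hx
  obtain ⟨g, hg⟩ := hcell.exists_cellMap_inter_nonempty hcover e
  have hc : Carries (hcell.homeomorph g⁻¹) (cellMap (hcell.isCellular g) e) e :=
    (carries_cellMap (hcell.isCellular g) e).symm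
  refine ⟨g⁻¹, ?_, _, hg, (hc.eq_cellMap (hcell.isCellular g⁻¹)).symm⟩
  have hI : cellMap (hcell.isCellular g) e ∈ K.I n := by
    by_contra hI
    obtain ⟨y, hyK, hy⟩ := hg
    exact disjoint_left.1
      (RelCWComplex.Subcomplex.disjoint_openCell_subcomplex_of_not_mem K hI) hy hyK
  rw [mem_ofPred_eq, ← hc.closedCell_eq] at hx
  exact image_mono (RelCWComplex.Subcomplex.closedCell_subset_of_mem K hI) hx

end Action

section Filling

variable {X : Type u} [TopologicalSpace X] [CombinatorialComplex X]

lemma norm₁_add_le {n : ℕ} (a b : Chain X n) : norm₁ (a + b) ≤ norm₁ a + norm₁ b := by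
  classical
  have h : ∀ c : Chain X n, c.support ⊆ a.support ∪ b.support →
      norm₁ c = ∑ i ∈ a.support ∪ b.support, (c i).natAbs := fun c hc =>
    Finsupp.sum_of_support_subset _ hc _ fun _ _ => rfl
  rw [h _ Finsupp.support_add, h a Finset.subset_union_left, h b Finset.subset_union_right,
    ← Finset.sum_add_distrib]
  exact Finset.sum_le_sum fun i _ => Int.natAbs_add_le _ _

/-- The chain `γ` is the boundary of a chain of `ℓ₁`-norm at most `B`. -/
def HasFilling (o : Orientation X) {d : ℕ} (γ : Chain X d) (B : ℕ) : Prop :=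
  ∃ μ : Chain X (d + 1), boundary o d μ = γ ∧ norm₁ μ ≤ B

lemma IsAcyclic.exists_hasFilling {o : Orientation X} {d : ℕ} (h : IsAcyclic o d)
    {γ : Chain X d} (hγ : γ ∈ cycles o d) : ∃ B, HasFilling o γ B := by
  have h1 : (Submodule.Quotient.mk ⟨γ, hγ⟩ : ReducedHomology o d) = 0 :=
    (h d le_rfl).elim _ _
  rw [Submodule.Quotient.mk_eq_zero] at h1
  obtain ⟨μ, hμ⟩ := h1
  exact ⟨norm₁ μ, μ, hμ, le_rfl⟩

lemma exists_face_eq_of_boundary_single_ne_zero {o : Orientation X} {n : ℕ} {e : Cell X (n + 1)}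
    {r : Cell X n} (h : boundary o n (Finsupp.single e 1) r ≠ 0) :
    ∃ σ : CWCell (boundaryCW e) n, face e σ = r := by
  classical
  rw [boundary, Finsupp.linearCombination_single, one_smul, ← Finsupp.mem_support_iff] at h
  obtain ⟨σ, -, hσ⟩ := Finset.mem_image.1 (Finsupp.mapDomain_support h)
  exact ⟨σ, hσ⟩

lemma map_zero_face_mem_closedCell {n k : ℕ} (e : Cell X n) (σ : CWCell (boundaryCW e) k) :
    cwMap cw (face e σ) 0 ∈ RelCWComplex.closedCell n e := by
  have h0 : (0 : Fin k → ℝ) ∈ closedBall (0 : Fin k → ℝ) 1 := mem_closedBall_self zero_le_one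
  rw [← map_face e σ 0 h0]
  exact mem_image_of_mem _ (cwMap_mem_closedDisc σ h0)

end Filling

/-- The filling norms of cycles of bounded `ℓ₁`-norm are bounded. -/
lemma exists_hasFilling_of_norm₁_le {X : Type u} [TopologicalSpace X] [T2Space X]
    [CombinatorialComplex X] {G : Type v} [Group G] [MulAction G X] (hcell : IsCellularAction G X)
    (hproper : IsProperAction G X) (hcocompact : IsCocompactAction G X) (o : Orientation X)
    (d : ℕ) (hacyclic : IsAcyclic o (d + 1)) (m : ℕ) :
    ∃ B, ∀ γ ∈ cycles o (d + 1), norm₁ γ ≤ m → HasFilling o γ B := by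
  obtain ⟨K, hK, hcover⟩ := hcocompact
  refine exists_bound_of_locally_finite (D := boundary o d) (P := fun γ B => HasFilling o γ B)
    ?_ ?_ ?_ ?_
    (finite_setOf_inter_cwOpenCell (cw (X := X)) hK (subset_univ _) (d + 1)) ?_ m
  · rintro γ B B' hBB' ⟨μ, hμ, hB⟩
    exact ⟨μ, hμ, hB.trans hBB'⟩
  · rintro γ γ' B B' ⟨μ, rfl, hB⟩ ⟨μ', rfl, hB'⟩
    exact ⟨μ + μ', map_add _ _ _, (norm₁_add_le _ _).trans (add_le_add hB hB')⟩
  · exact fun γ hγ => hacyclic.exists_hasFilling hγ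
  · intro e
    refine (((boundary o d (Finsupp.single e 1)).support.finite_toSet).biUnion fun r _ =>
      finite_setOf_mem_closedCell hcell hproper hK hcover (d + 1) (cwMap cw r 0)).subset ?_
    rintro e' ⟨r, hr, hr'⟩
    refine mem_biUnion (Finsupp.mem_support_iff.2 hr) ?_
    obtain ⟨σ, rfl⟩ := exists_face_eq_of_boundary_single_ne_zero hr'
    exact map_zero_face_mem_closedCell e' σ
  · intro γ e hγ he
    obtain ⟨g, hg⟩ := hcell.exists_cellMap_inter_nonempty hcover e
    have hf := hcell.isCellular g
    refine ⟨chainMap o hf _ γ, ?_, norm₁_chainMap o hf γ,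
      ⟨_, hg, (chainMap_apply_cellMap_ne_zero o hf).2 he⟩, ?_⟩
    · rw [boundary_chainMap, hγ, map_zero]
    · rintro B ⟨μ, hμ, hB⟩
      obtain ⟨ν, rfl⟩ := chainMap_surjective o hf _ μ
      rw [boundary_chainMap] at hμ
      exact ⟨ν, chainMap_injective o hf _ hμ, (norm₁_chainMap o hf ν).symm.trans_le hB⟩

end CombinatorialComplex

theorem theorem1p1 {X : Type u} [TopologicalSpace X] [T2Space X] [CombinatorialComplex X]
    {G : Type v} [Group G] [MulAction G X]
    (hcell : CombinatorialComplex.IsCellularAction G X)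
    (hproper : CombinatorialComplex.IsProperAction G X)
    (hcocompact : CombinatorialComplex.IsCocompactAction G X)
    (o : CombinatorialComplex.Orientation X)
    (d : ℕ) (hd : 0 < d) (hacyclic : CombinatorialComplex.IsAcyclic o d) (m : ℕ) :
    CombinatorialComplex.fillingFunction o d m < ⊤ := by
  obtain ⟨d, rfl⟩ := Nat.exists_eq_succ_of_ne_zero hd.ne'
  obtain ⟨B, hB⟩ := CombinatorialComplex.exists_hasFilling_of_norm₁_le hcell hproper hcocompact o d
    hacyclic m
  refine lt_of_le_of_lt (b := (B : ℕ∞)) ?_ (ENat.natCast_lt_top B)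
  refine iSup_le fun γ => iSup_le fun hγ => iSup_le fun hm => ?_
  obtain ⟨μ, hμ, hμB⟩ := hB γ hγ hm
  exact (iInf₂_le μ hμ).trans (by exact_mod_cast hμB)
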